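/- Let $G=(V,E)$ be a finite simple undirected graph of processes, $V_t\subseteq V$ a set of trusted nodes, and $f\ge 0$ an integer; no process uses signatures. Up to $f$ nodes, all in $V\setminus V_t$, may be Byzantine; all other nodes are correct. Each edge is a reliable, authenticated, asynchronous channel: the receiver knows which neighbor sent a message, and messages to correct processes are neither altered nor lost, and are eventually received. The protocol DolevU-T works as follows. To broadcast a payload $m$ (from a nonempty set of payloads), a process $s$ sends $[s,m,\emptyset]$, with an empty dissemination path, to all its neighbors and delivers $(s,m)$. When a process $p_i$ receives $[s,m,path]$ from its neighbor $p_j$, it sets $fwd=path+[p_j]$, stores for the pair $(s,m)$ the path obtained from $fwd$ by removing all trusted nodes and the broadcaster $s$, and sends $[s,m,fwd]$ to all its neighbors that are not in $fwd$. A process that has not yet delivered $(s,m)$, and whose stored paths for $(s,m)$ include the empty path or $f+1$ pairwise vertex-disjoint paths, eventually delivers $(s,m)$. Correct processes follow this protocol, and Byzantine processes may send arbitrary messages to their neighbors. Two distinct nodes $u,v$ *can communicate reliably using DolevU-T in $G$* if, for every set $B\subseteq V\setminus(V_t\cup\{u,v\})$ of Byzantine nodes with $|B|\le f$ and every execution,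 the following holds for $(s,r)=(u,v)$ and for $(s,r)=(v,u)$ and every payload $m$: $r$ delivers $(s,m)$ at most once; if $r$ delivers $(s,m)$, then $s$ has broadcast $m$; and if $s$ broadcasts $m$, then $r$ eventually delivers $(s,m)$. Let $f(G)$ be the graph with vertex set $V\setminus V_t$ in which two distinct nodes $x,y$ are adjacent iff $xy\in E$ or there are $t_0,\dots,t_n\in V_t$ ($n\ge 0$) with $xt_0,\ t_0t_1,\ \dots,\ t_{n-1}t_n,\ t_ny\in E$. Let $\Gamma_{f(G)}(v)$ be the set of neighbors of $v$ in $f(G)$, and let $\kappa_{f(G)}(u,v)$ be the least size of a set of vertices of $f(G)$ other than $u,v$ that meets every path from $u$ to $v$ in $f(G)$ ($\infty$ if there is no such set). **Theorem.** Two distinct untrusted nodes $u,v\in V\setminus V_t$ can communicate reliably using DolevU-T in $G$ if and only if $u\in\Gamma_{f(G)}(v)$ or $\kappa_{f(G)}(u,v)\ge 2f+1$. -/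

import Mathlib

/-! ## Graph notions -/

/-- `S` separates `a` from `b` in `H`: it contains neither of them and every walk from `a` to `b`
meets it. -/
def SimpleGraph.IsVertexSeparator {W : Type*} (H : SimpleGraph W) (a b : W) (S : Finset W) : Prop :=
  a ∉ S ∧ b ∉ S ∧ ∀ p : H.Walk a b, ∃ z ∈ p.support, z ∈ S

/-- The vertex-connectivity `κ_H(a, b)` of two vertices: the least number of other vertices whose
removal disconnects them (`⊤` if no removal does, that is, when they are adjacent or equal). -/
noncomputable def SimpleGraph.localVertexConnectivity {W : Type*} (H : SimpleGraph W) (a b : W) :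
    ℕ∞ :=
  ⨅ (S : Finset W) (_ : H.IsVertexSeparator a b S), (S.card : ℕ∞)

namespace DolevUT

/-- The graph `f(G)` on the untrusted nodes: two distinct untrusted nodes are joined when they are
adjacent in `G` or linked in `G` by a path `t 0, …, t n` of trusted nodes. -/
def untrustedGraph {V : Type*} (G : SimpleGraph V) (T : Set V) : SimpleGraph {x : V // x ∉ T} where
  Adj x y := x ≠ y ∧ (G.Adj x y ∨ ∃ (n : ℕ) (t : ℕ → V), (∀ i ≤ n, t i ∈ T) ∧
    G.Adj x (t 0) ∧ G.Adj (t n) y ∧ ∀ i < n, G.Adj (t i) (t (i + 1)))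
  symm := ⟨by
    rintro x y ⟨hne, h⟩
    refine ⟨hne.symm, ?_⟩
    rcases h with h | ⟨n, t, hT, h0, hn, hs⟩
    · exact Or.inl h.symm
    · refine Or.inr ⟨n, fun i => t (n - i), fun i _ => hT _ (Nat.sub_le n i), ?_, ?_, ?_⟩
      · simpa using hn.symm
      · simpa using h0.symm
      · intro i hi
        have h1 : n - i = (n - (i + 1)) + 1 := by omega
        have h2 := (hs (n - (i + 1)) (by omega)).symm
        simpa only [h1] using h2⟩
  loopless := ⟨fun _ h => h.1 rfl⟩

/-! ## The protocol -/

/-- A protocol message: the payload `payload` broadcast by `origin`, with a dissemination path. -/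
structure Message (V M : Type*) where
  origin : V
  payload : M
  path : List V

/-- A message in transit on the channel from `src` to `dst`. -/
structure Packet (V M : Type*) where
  src : V
  dst : V
  msg : Message V M

/-- The local variables of a process, for every broadcast instance `(origin, payload)`. -/
structure LocalState (V M : Type*) where
  /-- the instances that have been delivered -/
  delivered : Set (V × M)
  /-- the dissemination paths collected for each instance -/
  paths : V × M → Set (List V)

/-- A global configuration: the local states and the messages in transit. -/
structure Config (V M : Type*) where
  loc : V → LocalState V M
  net : Multiset (Packet V M)

/-- The events of an execution. -/
inductive Event (V M : Type*) where
  /-- process `i` RC-broadcasts `m` -/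
  | broadcast (i : V) (m : M)
  /-- the packet `p` is received by `p.dst` -/
  | receive (p : Packet V M)
  /-- process `i` RC-delivers the payload `m` as a broadcast of `s` -/
  | deliver (i s : V) (m : M)
  /-- a Byzantine process puts the packet `p` on one of its channels -/
  | byzSend (p : Packet V M)
  | idle

/-- The initial configuration. -/
def Config.init (V M : Type*) : Config V M where
  loc _ := ⟨∅, fun _ => ∅⟩
  net := 0

open scoped Classical in
/-- The packets by which `i` sends `x` to all its neighbors outside `avoid`. -/
noncomputable def sendAll {V M : Type*} [Fintype V] (G : SimpleGraph V) (i : V) (avoid : List V)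
    (x : Message V M) : Multiset (Packet V M) :=
  (Finset.univ.filter fun k => G.Adj i k ∧ k ∉ avoid).val.map fun k => ⟨i, k, x⟩

open scoped Classical in
/-- The path that is stored when `fwd` (the received path extended by the sender's identity) is a
dissemination path of a broadcast of `s`: trusted nodes and the broadcaster are removed. -/
noncomputable def storedPath {V : Type*} (T : Set V) (s : V) (fwd : List V) : List V :=
  fwd.filter fun x => x ∉ T ∧ x ≠ s

/-- The condition on the collected paths under which a process delivers: the empty path, or
`f + 1` vertex-disjoint paths. -/
def DeliveryCondition {V : Type*} (f : ℕ) (P : Set (List V)) : Prop :=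
  [] ∈ P ∨ ∃ Q : Finset (List V), ↑Q ⊆ P ∧ Q.card = f + 1 ∧ (Q : Set (List V)).Pairwise List.Disjoint

/-- Which events may occur in configuration `c` when `B` is the set of Byzantine processes.
Channels are authenticated: a Byzantine process only uses the channels to its neighbors. -/
def Enabled {V M : Type*} (G : SimpleGraph V) (f : ℕ) (B : Finset V) (c : Config V M) :
    Event V M → Prop
  | .broadcast i _ => i ∉ B
  | .receive p => p ∈ c.net
  | .deliver i s m => i ∉ B ∧ (s, m) ∉ (c.loc i).delivered ∧
      DeliveryCondition f ((c.loc i).paths (s, m))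
  | .byzSend p => p.src ∈ B ∧ G.Adj p.src p.dst
  | .idle => True

open scoped Classical in
/-- The local state of a process after it has received `p`. -/
noncomputable def LocalState.store {V M : Type*} (T : Set V) (σ : LocalState V M)
    (p : Packet V M) : LocalState V M where
  delivered := σ.delivered
  paths := Function.update σ.paths (p.msg.origin, p.msg.payload)
    (insert (storedPath T p.msg.origin (p.msg.path ++ [p.src]))
      (σ.paths (p.msg.origin, p.msg.payload)))

/-- The local state of a process after it has delivered the instance `(s, m)`. -/
def LocalState.markDelivered {V M : Type*} (σ : LocalState V M) (s : V) (m : M) :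
    LocalState V M where
  delivered := insert (s, m) σ.delivered
  paths := σ.paths

open scoped Classical in
/-- The effect of an event. A correct process that broadcasts sends its payload with the empty path
to all its neighbors and delivers it; a correct process that receives a message appends the sender
to the path, stores the simplified path, and forwards the message with the extended path to its
neighbors outside this path. What a Byzantine process receives only leaves the channel. -/
noncomputable def next {V M : Type*} [Fintype V] (G : SimpleGraph V) (T : Set V) (B : Finset V)
    (c : Config V M) : Event V M → Config V M
  | .broadcast i m =>
      { loc := Function.update c.loc i ((c.loc i).markDelivered i m)
        net := c.net + sendAll G i [] ⟨i, m, []⟩ }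
  | .receive p =>
      if p.dst ∈ B then { loc := c.loc, net := c.net.erase p }
      else
        { loc := Function.update c.loc p.dst ((c.loc p.dst).store T p)
          net := c.net.erase p + sendAll G p.dst (p.msg.path ++ [p.src])
            ⟨p.msg.origin, p.msg.payload, p.msg.path ++ [p.src]⟩ }
  | .deliver i s m =>
      { loc := Function.update c.loc i ((c.loc i).markDelivered s m), net := c.net }
  | .byzSend p => { loc := c.loc, net := p ::ₘ c.net }
  | .idle => c

/-- The infinite asynchronous executions of the protocol with the set `B` of Byzantine processes:
every message to a correct process is eventually received, and no delivery stays enabled forever. -/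
structure Execution {V : Type*} (M : Type*) [Fintype V] (G : SimpleGraph V) (T : Set V) (f : ℕ)
    (B : Finset V) where
  config : ℕ → Config V M
  event : ℕ → Event V M
  init : config 0 = Config.init V M
  enabled : ∀ t, Enabled G f B (config t) (event t)
  step : ∀ t, config (t + 1) = next G T B (config t) (event t)
  fair_receive : ∀ t, ∀ p ∈ (config t).net, p.dst ∉ B → ∃ t' ≥ t, event t' = .receive p
  fair_deliver : ∀ t i s m, ∃ t' ≥ t, ¬ Enabled G f B (config t') (.deliver i s m)

namespace Execution

variable {V M : Type*} [Fintype V] {G : SimpleGraph V} {T : Set V} {f : ℕ} {B : Finset V}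

/-- At time `t`, process `r` RC-delivers `m` as a broadcast of `s`; a broadcaster delivers its own
payload when it broadcasts it. -/
def DeliversAt (E : Execution M G T f B) (t : ℕ) (r s : V) (m : M) : Prop :=
  E.event t = .deliver r s m ∨ (E.event t = .broadcast r m ∧ s = r)

/-- The reliable communication properties for the broadcasts of `s` and their deliveries by `r`:
no duplication, no creation, and validity. -/
def ReliableFromTo (E : Execution M G T f B) (s r : V) : Prop :=
  (∀ m t t', E.DeliversAt t r s m → E.DeliversAt t' r s m → t = t') ∧
  (∀ m t, E.DeliversAt t r s m → ∃ t' ≤ t, E.event t' = .broadcast s m) ∧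
  (∀ m t, E.event t = .broadcast s m → ∃ t', E.DeliversAt t' r s m)

end Execution

/-- `u` and `v` can communicate reliably using the protocol in `G`: whatever set of at most `f`
untrusted nodes other than `u` and `v` is Byzantine, in every execution each of the two reliably
receives the broadcasts of the other. -/
def CommunicateReliably {V : Type*} (M : Type*) [Fintype V] (G : SimpleGraph V) (T : Set V) (f : ℕ)
    (u v : V) : Prop :=
  ∀ B : Finset V, B.card ≤ f → (∀ b ∈ B, b ∉ T) → u ∉ B → v ∉ B →
    ∀ E : Execution M G T f B, E.ReliableFromTo u v ∧ E.ReliableFromTo v u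

end DolevUT

/-! Trusted nodes forward faithfully and are erased from stored paths. What matters about a message
is therefore the sequence of untrusted nodes it visits, and this traces a walk in f(G). The theorem
is Dolev's 2f+1 bound in that graph.

No duplication and no creation need no connectivity. Until a correct `s` broadcasts `m`, every path
travelling under `(s, m)` names a Byzantine node, because channels reveal their sender
(`byzantine_mem_path`). At most f nodes thus meet all stored paths, which excludes both the empty
path and f+1 disjoint ones (`not_deliveryCondition`).

Sufficiency: if u and v are adjacent in f(G), a message arrives whose stored path is empty.
Otherwise every separator has at least 2f+1 nodes, so f+1 internally disjoint walks survive the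
removal of at most f Byzantine nodes, by Menger's theorem
(`exists_disjoint_walks_of_separator_card`). Their lifts to G may share trusted nodes, but these are
erased, so the stored paths are still disjoint.

Necessity: split a separator of at most 2f nodes into a set B of silent Byzantine nodes and a rest,
each of size at most f. Every message that reaches v has crossed the separator at a correct node,
hence in the rest, and v cannot deliver. A fair infinite execution of this kind has to be exhibited
(`exists_genuine_execution`). It exists because dissemination paths never repeat a node, so the
traffic dies out. -/

namespace SimpleGraph

/-! ### Menger's theorem for sets, by deletion of an edge. -/

variable {V : Type*} {G : SimpleGraph V}

/-- A walk that meets a set has an initial part that meets it only in its last vertex. -/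
lemma Walk.exists_initial {a b : V} (p : G.Walk a b) (C : Set V) (h : ∃ z ∈ p.support, z ∈ C) :
    ∃ c ∈ C, ∃ q : G.Walk a c, q.support ⊆ p.support ∧ ∀ t ∈ q.support, t ∈ C → t = c := by
  induction p with
  | nil =>
    obtain ⟨z, hz, hzC⟩ := h
    simp only [Walk.support_nil, List.mem_singleton] at hz
    subst hz
    exact ⟨z, hzC, .nil, by simp, by simp⟩
  | @cons a a' b hadj p ih =>
    by_cases ha : a ∈ C
    · exact ⟨a, ha, .nil, by simp, by simp⟩
    · obtain ⟨c, hc, q, hq, hqC⟩ := ih (by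
        obtain ⟨z, hz, hzC⟩ := h
        refine ⟨z, ?_, hzC⟩
        rcases List.mem_cons.1 (by simpa using hz) with rfl | hz
        · exact absurd hzC ha
        · exact hz)
      refine ⟨c, hc, .cons hadj q, ?_, ?_⟩
      · rw [Walk.support_cons, Walk.support_cons]
        exact List.cons_subset_cons _ hq
      · intro t ht htC
        rcases List.mem_cons.1 (by simpa using ht) with rfl | ht
        · exact absurd htC ha
        · exact hqC t ht htC

/-- A walk that does not visit both ends of a deleted edge survives the deletion. -/
lemma Walk.exists_deleteEdges {a b x y : V} (p : G.Walk a b) {e : Sym2 V} (he : e = s(x, y))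
    (h : ¬ (x ∈ p.support ∧ y ∈ p.support)) :
    ∃ q : (G.deleteEdges {e}).Walk a b, q.support = p.support := by
  subst he
  exact ⟨p.toDeleteEdge s(x, y) fun he =>
      h ⟨p.fst_mem_support_of_mem_edges he, p.snd_mem_support_of_mem_edges he⟩,
    by simp [Walk.toDeleteEdge, Walk.toDeleteEdges]⟩

/-- The part of the walk up to its first vertex in `C` cannot contain both `x` and `y`, so it does
not use the deleted edge. -/
lemma Walk.exists_initial_deleteEdges {a b x y : V} (p : G.Walk a b) (C : Set V) {e : Sym2 V} (he : e = s(x, y)) (hxy : x ≠ y)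
    (hx : x ∈ C) (hy : y ∈ C) (h : ∃ z ∈ p.support, z ∈ C) :
    ∃ c ∈ C, ∃ q : (G.deleteEdges {e}).Walk a c,
      q.support ⊆ p.support ∧ ∀ t ∈ q.support, t ∈ C → t = c := by
  obtain ⟨c, hc, q, hq, hqC⟩ := p.exists_initial C h
  obtain ⟨q', hq'⟩ := q.exists_deleteEdges he
    fun h => hxy ((hqC x h.1 hx).trans (hqC y h.2 hy).symm)
  exact ⟨c, hc, q', by rwa [hq'], by rwa [hq']⟩

/-- `S` meets every walk from `A` to `B`. -/
def SeparatesSets (G : SimpleGraph V) (A B : Set V) (S : Finset V) : Prop :=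
  ∀ a ∈ A, ∀ b ∈ B, ∀ p : G.Walk a b, ∃ z ∈ p.support, z ∈ S

lemma SeparatesSets.symm {A B : Set V} {S : Finset V} (h : G.SeparatesSets A B S) :
    G.SeparatesSets B A S := fun b hb a ha p => by
  simpa using h a ha b hb p.reverse

/-- There are `k` pairwise disjoint walks from `A` to `B`. -/
def HasDisjointWalks (G : SimpleGraph V) (A B : Set V) (k : ℕ) : Prop :=
  ∃ (a b : Fin k → V) (p : ∀ i, G.Walk (a i) (b i)), (∀ i, a i ∈ A) ∧ (∀ i, b i ∈ B) ∧
    ∀ i j, i ≠ j → List.Disjoint (p i).support (p j).support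

/-- `k` disjoint walks into a set of `k` vertices end in all of its vertices. -/
lemma HasDisjointWalks.exists_isPath {A : Set V} {P : Finset V}
    (h : G.HasDisjointWalks A P P.card) :
    ∃ (a : P → V) (p : ∀ z : P, G.Walk (a z) z), (∀ z, a z ∈ A) ∧ (∀ z, (p z).IsPath) ∧
      ∀ z z', z ≠ z' → List.Disjoint (p z).support (p z').support := by
  classical
  obtain ⟨a, b, p, ha, hb, hd⟩ := h
  let g : Fin P.card → P := fun i => ⟨b i, hb i⟩
  have hg : Function.Injective g := by
    intro i j hij
    by_contra hne
    have hbij : b i = b j := congrArg Subtype.val hij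
    exact hd i j hne (p i).end_mem_support (by rw [hbij]; exact (p j).end_mem_support)
  have hsurj : Function.Surjective g :=
    ((Fintype.bijective_iff_injective_and_card g).2 ⟨hg, by simp⟩).2
  have key : ∀ z : P, ∃ (i : Fin P.card) (q : G.Walk (a i) z),
      g i = z ∧ q.IsPath ∧ q.support ⊆ (p i).support := by
    intro z
    obtain ⟨i, rfl⟩ := hsurj z
    exact ⟨i, (p i).bypass, rfl, (p i).bypass_isPath, (p i).support_bypass_subset_support⟩
  choose i q hi hq hsub using key
  refine ⟨fun z => a (i z), q, fun z => ha _, hq, fun z z' hne t ht ht' => ?_⟩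
  refine hd (i z) (i z') (fun h => hne ?_) (hsub z ht) (hsub z' ht')
  rw [← hi z, ← hi z', h]

/-- The vertices of a too small separator `S` of `G - xy`, together with `x`, are the ends of
disjoint paths from `A`. -/
lemma exists_paths_insert [DecidableEq V] {A B : Set V} {S : Finset V} {k : ℕ} {x y : V} {e : Sym2 V}
    (he : e = s(x, y)) (hxy : x ≠ y)
    (hk : ∀ Z, G.SeparatesSets A B Z → k ≤ Z.card)
    (IH : ∀ P : Set V, (∀ Z, (G.deleteEdges {e}).SeparatesSets A P Z → k ≤ Z.card) →
      (G.deleteEdges {e}).HasDisjointWalks A P k)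
    (hS : (G.deleteEdges {e}).SeparatesSets A B S) (hSk : S.card < k)
    {b : V} (hb : b ∈ B) (β : (G.deleteEdges {e}).Walk y b)
    (hβ : ∀ z ∈ β.support, z ∉ S) :
    x ∉ S ∧ S.card + 1 = k ∧
    ∃ (a : ↥(insert x S) → V) (p : ∀ z : ↥(insert x S), (G.deleteEdges {e}).Walk (a z) z),
      (∀ z, a z ∈ A) ∧ (∀ z, (p z).IsPath) ∧
      ∀ z z', z ≠ z' → List.Disjoint (p z).support (p z').support := by
  -- A walk that avoids `x` does not use the edge, so `S` meets it. Now `k ≤ |S ∪ {x}|` and `|S| <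
  -- k` determine both cardinalities.
  have hsep : G.SeparatesSets A B (insert x S) := by
    intro a ha b hb p
    by_contra! hcon
    obtain ⟨q, hq⟩ := p.exists_deleteEdges he
      fun h => hcon x h.1 (Finset.mem_insert_self _ _)
    obtain ⟨z, hz, hzS⟩ := hS a ha b hb q
    exact hcon z (hq ▸ hz) (Finset.mem_insert_of_mem hzS)
  have h1 := hk _ hsep
  have hx : x ∉ S := fun h => by rw [Finset.insert_eq_of_mem h] at h1; omega
  have hcard : (insert x S).card = k := by
    rw [Finset.card_insert_of_notMem hx] at h1 ⊢; omega
  refine ⟨hx, by rw [← hcard, Finset.card_insert_of_notMem hx], ?_⟩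
  apply HasDisjointWalks.exists_isPath
  rw [hcard]
  refine IH _ fun Z hZ => hk Z ?_
  intro a ha b' hb' p
  obtain ⟨z, hz, hzS⟩ := hsep a ha b' hb' p
  obtain ⟨c, hc, q, hq, hqC⟩ := p.exists_initial_deleteEdges (insert y (insert x (S : Set V))) he hxy
    (by simp) (by simp) ⟨z, hz, Set.mem_insert_of_mem _ (by simpa using hzS)⟩
  -- If the first hit is `y` outside `S`, continuing along `β` gives a walk of `G - xy` from `A` to
  -- `B` that avoids `S`, which is impossible.
  by_cases hcS : c ∈ insert x S
  · obtain ⟨z, hz, hzZ⟩ := hZ a ha c hcS q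
    exact ⟨z, hq hz, hzZ⟩
  · have hcy : c = y := by
      rcases hc with h | h
      · exact h
      · exact absurd (by simpa using h) hcS
    subst hcy
    obtain ⟨t, ht, htS⟩ := hS a ha b hb (q.append β)
    rcases (Walk.mem_support_append_iff _ _).1 ht with ht | ht
    · have := hqC t ht (by simp [htS])
      subst this
      exact absurd (Finset.mem_insert_of_mem htS) hcS
    · exact absurd htS (hβ t ht)

/-- The inductive step of Menger's theorem. In `G - xy` there are `k` disjoint paths from `A` onto
`S ∪ {x}` and `k` from `B` onto `S ∪ {y}`. They are glued at the vertices of `S` and across the edge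
`xy`. -/
lemma hasDisjointWalks_of_deleteEdges {A B : Set V} {S : Finset V} {k : ℕ} {x y : V} {e : Sym2 V}
    (he : e = s(x, y)) (hxy : G.Adj x y)
    (hk : ∀ Z, G.SeparatesSets A B Z → k ≤ Z.card)
    (IH : ∀ A P : Set V, (∀ Z, (G.deleteEdges {e}).SeparatesSets A P Z → k ≤ Z.card) →
      (G.deleteEdges {e}).HasDisjointWalks A P k)
    (hS : (G.deleteEdges {e}).SeparatesSets A B S) (hSk : S.card < k)
    {a b : V} (ha : a ∈ A) (hb : b ∈ B) (α : (G.deleteEdges {e}).Walk a x)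
    (hα : ∀ z ∈ α.support, z ∉ S) (β : (G.deleteEdges {e}).Walk y b)
    (hβ : ∀ z ∈ β.support, z ∉ S) : G.HasDisjointWalks A B k := by
  classical
  obtain ⟨hx, hcard, a', p, ha', hpp, hpd⟩ :=
    exists_paths_insert he hxy.ne hk (IH A) hS hSk hb β hβ
  obtain ⟨hy, -, b', q, hb', hqp, hqd⟩ :=
    exists_paths_insert (he.trans Sym2.eq_swap) hxy.ne' (fun Z hZ => hk Z hZ.symm) (IH B) hS.symm
      hSk ha α.reverse (by simpa using hα)
  have hpP : ∀ z : ↥(insert x S), ∀ t ∈ (p z).support, t ∈ insert x S → t = z := by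
    intro z t ht htP
    by_contra hne
    exact hpd z ⟨t, htP⟩ (fun h => hne (by rw [h])) ht (p ⟨t, htP⟩).end_mem_support
  have hqQ : ∀ z : ↥(insert y S), ∀ t ∈ (q z).support, t ∈ insert y S → t = z := by
    intro z t ht htP
    by_contra hne
    exact hqd z ⟨t, htP⟩ (fun h => hne (by rw [h])) ht (q ⟨t, htP⟩).end_mem_support
  -- A common vertex `c` yields a walk of `G - xy` from `A` to `B`, which meets `S`. Each path meets
  -- its target set only at its end, so `c` is that end and lies in `S`.
  have cross : ∀ (z : ↥(insert x S)) (w : ↥(insert y S)) (c : V), c ∈ (p z).support →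
      c ∈ (q w).support → (z : V) = w := by
    intro z w c hcp hcq
    obtain ⟨s, hs, hsS⟩ := hS _ (ha' z) _ (hb' w)
      (((p z).takeUntil c hcp).append ((q w).takeUntil c hcq).reverse)
    rcases (Walk.mem_support_append_iff _ _).1 hs with hs | hs
    · have hsz := hpP z s ((p z).support_takeUntil_subset_support hcp hs)
        (Finset.mem_insert_of_mem hsS)
      have hcz : c = z := by
        by_contra hne
        exact Walk.endpoint_notMem_support_takeUntil (hpp z) hcp (Ne.symm hne) (hsz ▸ hs)
      exact hcz ▸ hqQ w c hcq (hcz ▸ hsz ▸ Finset.mem_insert_of_mem hsS)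
    · rw [Walk.support_reverse, List.mem_reverse] at hs
      have hsz := hqQ w s ((q w).support_takeUntil_subset_support hcq hs)
        (Finset.mem_insert_of_mem hsS)
      have hcz : c = w := by
        by_contra hne
        exact Walk.endpoint_notMem_support_takeUntil (hqp w) hcq (Ne.symm hne) (hsz ▸ hs)
      exact hcz ▸ (hpP z c hcp (hcz ▸ hsz ▸ Finset.mem_insert_of_mem hsS)).symm
  have hle : G.deleteEdges {e} ≤ G := deleteEdges_le _
  have join : ∀ z : ↥(insert x S), ∃ (w : ↥(insert y S)) (r : G.Walk (a' z) (b' w)),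
      ((z : V) = x ∧ (w : V) = y ∨ (z : V) = w) ∧
      ∀ t ∈ r.support, t ∈ (p z).support ∨ t ∈ (q w).support := by
    rintro ⟨z, hz⟩
    rcases Finset.mem_insert.1 hz with rfl | hzS
    · refine ⟨⟨y, Finset.mem_insert_self _ _⟩, ((p ⟨z, hz⟩).mapLe hle).append
        (.cons hxy ((q ⟨y, Finset.mem_insert_self _ _⟩).mapLe hle).reverse), Or.inl ⟨rfl, rfl⟩, ?_⟩
      intro t ht
      rcases (Walk.mem_support_append_iff _ _).1 ht with ht | ht
      · exact Or.inl (by simpa using ht)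
      · rcases List.mem_cons.1 (by simpa only [Walk.support_cons] using ht) with rfl | ht
        · exact Or.inl (p ⟨t, hz⟩).end_mem_support
        · exact Or.inr (by simpa using ht)
    · refine ⟨⟨z, Finset.mem_insert_of_mem hzS⟩, ((p ⟨z, hz⟩).mapLe hle).append
        ((q ⟨z, Finset.mem_insert_of_mem hzS⟩).mapLe hle).reverse, Or.inr rfl, ?_⟩
      intro t ht
      rcases (Walk.mem_support_append_iff _ _).1 ht with ht | ht
      · exact Or.inl (by simpa using ht)
      · exact Or.inr (by simpa using ht)
  choose σ r hσ hr using join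
  have hσc : ∀ z z' : ↥(insert x S), (z : V) = σ z' → z = z' := by
    intro z z' h
    rcases hσ z' with ⟨h1, h2⟩ | h1
    · exfalso
      have := z.2
      rw [h, h2] at this
      rcases Finset.mem_insert.1 this with h | h
      · exact hxy.ne h.symm
      · exact hy h
    · exact Subtype.ext (h.trans h1.symm)
  have hσi : ∀ z z' : ↥(insert x S), σ z = σ z' → z = z' := by
    intro z z' h
    rcases hσ z with ⟨h1, h2⟩ | h1
    · rcases hσ z' with ⟨h1', h2'⟩ | h1'
      · exact Subtype.ext (h1.trans h1'.symm)
      · exact (hσc z' z (by rw [h, h1'])).symm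
    · exact hσc z z' (by rw [h1, h])
  have hcard' : (insert x S).card = k := by rw [Finset.card_insert_of_notMem hx, hcard]
  let g : Fin k ≃ ↥(insert x S) := (finCongr hcard'.symm).trans (insert x S).equivFin.symm
  refine ⟨fun i => a' (g i), fun i => b' (σ (g i)), fun i => r (g i), fun i => ha' _,
    fun i => hb' _, fun i j hij t ht ht' => ?_⟩
  have hne : g i ≠ g j := fun h => hij (g.injective h)
  rcases hr _ t ht with h | h <;> rcases hr _ t ht' with h' | h'
  · exact hpd _ _ hne h h'
  · exact hne (hσc _ _ (cross _ _ t h h'))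
  · exact hne (hσc _ _ (cross _ _ t h' h)).symm
  · exact hqd _ _ (fun h => hne (hσi _ _ h)) h h'

/-- **Menger's theorem** for two sets of vertices. -/
theorem hasDisjointWalks_of_forall_separatesSets [Finite V] (G : SimpleGraph V) (A B : Set V)
    (k : ℕ) (hk : ∀ S, G.SeparatesSets A B S → k ≤ S.card) : G.HasDisjointWalks A B k := by
  classical
  induction G using WellFoundedLT.induction generalizing A B with
  | ind G ih =>
  by_cases hG : G = ⊥
  · subst hG
    have hfin : (A ∩ B).Finite := Set.toFinite _
    have hle : k ≤ hfin.toFinset.card := by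
      -- Without edges all walks are trivial, so `A ∩ B` is a separator.
      refine hk _ fun a ha b hb p => ?_
      cases p with
      | nil => exact ⟨a, by simp, by simp [ha, hb]⟩
      | cons h => exact absurd h (by simp)
    let e : Fin k → hfin.toFinset := fun i => hfin.toFinset.equivFin.symm (Fin.castLE hle i)
    have he : ∀ i, (e i : V) ∈ A ∩ B := fun i => hfin.mem_toFinset.1 (e i).2
    refine ⟨fun i => e i, fun i => e i, fun i => .nil, fun i => (he i).1, fun i => (he i).2, ?_⟩
    intro i j hij
    simp only [Walk.support_nil, List.disjoint_singleton, List.mem_singleton]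
    intro h
    apply hij
    simpa [e] using Subtype.ext h.symm
  · obtain ⟨x, y, hxy⟩ := ne_bot_iff_exists_adj.1 hG
    have hlt : G.deleteEdges {s(x, y)} < G :=
      lt_of_le_of_ne (deleteEdges_le _) fun h => by
        have := h ▸ hxy
        simp at this
    by_cases hall : ∀ S, (G.deleteEdges {s(x, y)}).SeparatesSets A B S → k ≤ S.card
    · obtain ⟨a, b, p, ha, hb, hd⟩ := ih _ hlt A B hall
      exact ⟨a, b, fun i => (p i).mapLe (deleteEdges_le _), ha, hb, by simpa using hd⟩
    · push Not at hall
      obtain ⟨S, hS, hSk⟩ := hall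
      have hnS : ¬ G.SeparatesSets A B S := fun h => by have := hk S h; omega
      simp only [SeparatesSets] at hnS
      push Not at hnS
      obtain ⟨a, ha, b, hb, R, hR⟩ := hnS
      have hRxy : ∃ z ∈ R.support, z ∈ ({x, y} : Set V) := by
        by_contra! hcon
        obtain ⟨q, hq⟩ := R.exists_deleteEdges rfl fun h => hcon x h.1 (by simp)
        obtain ⟨z, hz, hzS⟩ := hS a ha b hb q
        exact hR z (hq ▸ hz) hzS
      obtain ⟨c, hc, α, hα, -⟩ := R.exists_initial_deleteEdges {x, y} rfl hxy.ne (by simp) (by simp) hRxy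
      obtain ⟨d, hd, β, hβ, -⟩ := R.reverse.exists_initial_deleteEdges {x, y} rfl hxy.ne
        (by simp) (by simp) (by simpa using hRxy)
      replace hα : ∀ z ∈ α.support, z ∉ S := fun z hz => hR z (hα hz)
      replace hβ : ∀ z ∈ β.reverse.support, z ∉ S := fun z hz => hR z (by
        simpa using hβ (by simpa using hz))
      -- The parts of `R` from its two ends reach different ends of `xy`: otherwise they would join
      -- to a walk of `G - xy` that avoids `S`.
      have hcd : c ≠ d := by
        rintro rfl
        obtain ⟨z, hz, hzS⟩ := hS a ha b hb (α.append β.reverse)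
        rcases (Walk.mem_support_append_iff _ _).1 hz with hz | hz
        · exact hα z hz hzS
        · exact hβ z hz hzS
      rcases hc with rfl | rfl <;> rcases hd with rfl | rfl
      · exact absurd rfl hcd
      · exact hasDisjointWalks_of_deleteEdges rfl hxy hk (fun A P h => ih _ hlt A P h) hS hSk ha hb
          α hα β.reverse hβ
      · exact hasDisjointWalks_of_deleteEdges Sym2.eq_swap hxy.symm hk (fun A P h => ih _ hlt A P h) hS hSk ha hb
          α hα β.reverse hβ
      · exact absurd rfl hcd

/-! ### Menger's theorem for two vertices, with forbidden vertices. -/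

/-- A walk that avoids a set of vertices survives the deletion of all edges at this set. -/
lemma Walk.exists_deleteEdges_incident {a b : V} (p : G.Walk a b) (F : Set V)
    (h : ∀ z ∈ p.support, z ∉ F) :
    ∃ q : (G.deleteEdges {e | ∃ z ∈ F, z ∈ e}).Walk a b, q.support = p.support :=
  ⟨p.toDeleteEdges _ fun e he hF => by
      obtain ⟨z, hz, hze⟩ := hF
      exact h z (p.mem_support_of_mem_edges he hze) hz,
    by simp [Walk.toDeleteEdges]⟩

/-- A walk in a graph without edges at `F` that starts outside `F` avoids `F`. -/
lemma Walk.notMem_of_mem_support_deleteEdges {F : Set V} {a b : V}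
    (p : (G.deleteEdges {e | ∃ z ∈ F, z ∈ e}).Walk a b) (ha : a ∉ F) : ∀ z ∈ p.support, z ∉ F := by
  induction p with
  | nil => simpa using ha
  | @cons a a' b hadj p ih =>
    have ha' : a' ∉ F := fun h => (deleteEdges_adj.1 hadj).2 ⟨a', h, by simp⟩
    intro z hz
    rcases List.mem_cons.1 (by simpa only [Walk.support_cons] using hz) with rfl | hz
    · exact ha
    · exact ih ha' z hz

/-- **Menger's theorem** for two nonadjacent vertices, with walks that avoid a given set `F`. -/
theorem exists_disjoint_walks_of_separator_card [Finite V] {u v : V} (huv : u ≠ v)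
    (hadj : ¬ G.Adj u v) (F : Finset V) (hu : u ∉ F) (hv : v ∉ F) (k : ℕ)
    (hk : ∀ S, G.IsVertexSeparator u v S → k + F.card ≤ S.card) :
    ∃ p : Fin k → G.Walk u v, (∀ i, ∀ z ∈ (p i).support, z ∉ F) ∧
      ∀ i j, i ≠ j → ∀ z ∈ (p i).support, z ∈ (p j).support → z = u ∨ z = v := by
  classical
  set F' : Set V := insert u (insert v (F : Set V)) with hF'
  have hle : G.deleteEdges {e | ∃ z ∈ F', z ∈ e} ≤ G := deleteEdges_le _
  -- The set version is applied between the neighborhoods of `u` and `v`; deleting the edges at `F ∪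
  -- {u, v}` keeps the walks away from these vertices. A separator `Z` there gives the separator `(Z
  -- ∪ F) \ {u, v}` of `u` and `v`, so `k + |F| ≤ |Z| + |F|`.
  obtain ⟨a, b, p, ha, hb, hd⟩ := hasDisjointWalks_of_forall_separatesSets
    (G.deleteEdges {e | ∃ z ∈ F', z ∈ e}) {x | G.Adj u x ∧ x ∉ F} {x | G.Adj v x ∧ x ∉ F} k (by
      intro Z hZ
      have hsep : G.IsVertexSeparator u v ((Z ∪ F) \ {u, v}) := by
        refine ⟨by simp, by simp, fun p => ?_⟩
        by_contra! hcon
        have hsub := p.support_bypass_subset_support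
        have hp := p.bypass_isPath
        generalize p.bypass = q at hsub hp
        cases q with
        | nil => exact huv rfl
        | @cons _ x _ hux q =>
          obtain ⟨hq, huq⟩ := (Walk.cons_isPath_iff _ _).1 hp
          have hsub' : ∀ z ∈ q.support, z ∈ p.support := fun z hz =>
            hsub (by simp [hz])
          have hq' := hq.reverse
          have hr : ∀ z, z ∈ q.reverse.support ↔ z ∈ q.support := by simp
          generalize q.reverse = r at hq' hr
          cases r with
          | nil => exact hadj hux
          | @cons _ y _ hvy r =>
            obtain ⟨-, hvr⟩ := (Walk.cons_isPath_iff _ _).1 hq'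
            have hrF : ∀ z ∈ r.support, z ∉ Z ∧ z ∉ F ∧ z ≠ u ∧ z ≠ v := by
              intro z hz
              have hzq : z ∈ q.support := (hr z).1 (by simp [hz])
              have h1 : z ≠ u := fun h => huq (h ▸ hzq)
              have h2 : z ≠ v := fun h => hvr (h ▸ hz)
              have h3 := hcon z (hsub' z hzq)
              simp only [Finset.mem_sdiff, Finset.mem_union, Finset.mem_insert,
                Finset.mem_singleton] at h3
              tauto
            obtain ⟨w, hw⟩ := r.exists_deleteEdges_incident F' (by
              intro z hz
              simpa [hF'] using ⟨(hrF z hz).2.2.1, (hrF z hz).2.2.2, (hrF z hz).2.1⟩)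
            obtain ⟨z, hz, hzZ⟩ := hZ x ⟨hux, (hrF x r.end_mem_support).2.1⟩ y
              ⟨hvy, (hrF y r.start_mem_support).2.1⟩ w.reverse
            exact (hrF z (by rw [← hw]; simpa using hz)).1 hzZ
      have h1 := hk _ hsep
      have h2 : ((Z ∪ F) \ {u, v}).card ≤ Z.card + F.card :=
        (Finset.card_le_card Finset.sdiff_subset).trans (Finset.card_union_le _ _)
      omega)
  have haF : ∀ i, a i ∉ F' := by
    intro i h
    rcases h with h | h | h
    · exact (ha i).1.ne h.symm
    · exact hadj (h ▸ (ha i).1)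
    · exact (ha i).2 h
  have hpF := fun i => (p i).notMem_of_mem_support_deleteEdges (haF i)
  have hsupp : ∀ i z, z ∈ (Walk.cons (ha i).1
      (((p i).mapLe hle).append (.cons (hb i).1.symm .nil))).support →
      z = u ∨ z ∈ (p i).support ∨ z = v := by
    intro i z hz
    rcases List.mem_cons.1 (by simpa only [Walk.support_cons] using hz) with rfl | hz
    · exact Or.inl rfl
    · rcases (Walk.mem_support_append_iff _ _).1 hz with hz | hz
      · exact Or.inr (Or.inl (by simpa using hz))
      · simp only [Walk.support_cons, Walk.support_nil, List.mem_cons, List.not_mem_nil,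
          or_false] at hz
        rcases hz with rfl | rfl
        · exact Or.inr (Or.inl (p i).end_mem_support)
        · exact Or.inr (Or.inr rfl)
  refine ⟨fun i => .cons (ha i).1 (((p i).mapLe hle).append (.cons (hb i).1.symm .nil)), ?_, ?_⟩
  · intro i z hz
    rcases hsupp i z hz with rfl | h | rfl
    · exact hu
    · exact fun hzF => hpF i z h (by simp [hF', hzF])
    · exact hv
  · intro i j hij z hz hz'
    rcases hsupp i z hz with h | h | h
    · exact Or.inl h
    · rcases hsupp j z hz' with h' | h' | h'
      · exact Or.inl h'
      · exact absurd h' (hd i j hij h)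
      · exact Or.inr h'
    · exact Or.inr h

end SimpleGraph

namespace DolevUT

variable {V M : Type*} {G : SimpleGraph V} {T : Set V} {f : ℕ} {B : Finset V}

/-! ## Walks in `G` and in the graph of the untrusted nodes -/

lemma exists_walk_of_chain (n : ℕ) (t : ℕ → V) (hs : ∀ i < n, G.Adj (t i) (t (i + 1))) :
    ∃ p : G.Walk (t 0) (t n), ∀ z ∈ p.support, ∃ i ≤ n, z = t i := by
  induction n with
  | zero => exact ⟨.nil, fun z hz => ⟨0, le_rfl, by simpa using hz⟩⟩
  | succ n ih =>
    obtain ⟨p, hp⟩ := ih fun i hi => hs i (by omega)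
    refine ⟨p.concat (hs n (by omega)), fun z hz => ?_⟩
    rw [SimpleGraph.Walk.support_concat, List.mem_append,
      List.mem_singleton] at hz
    rcases hz with hz | rfl
    · obtain ⟨i, hi, rfl⟩ := hp z hz
      exact ⟨i, by omega, rfl⟩
    · exact ⟨n + 1, le_rfl, rfl⟩

lemma exists_walk_of_untrustedGraph_adj {x y : {x : V // x ∉ T}}
    (h : (untrustedGraph G T).Adj x y) :
    ∃ p : G.Walk x y, ∀ z ∈ p.support, z ∉ T → z = x ∨ z = y := by
  obtain ⟨-, h | ⟨n, t, hT, h0, hn, hs⟩⟩ := h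
  · refine ⟨.cons h .nil, fun z hz _ => by simpa using hz⟩
  · obtain ⟨p, hp⟩ := exists_walk_of_chain n t hs
    refine ⟨.cons h0 (p.concat hn), fun z hz hzT => ?_⟩
    rw [SimpleGraph.Walk.support_cons, SimpleGraph.Walk.support_concat,
      List.mem_cons, List.mem_append, List.mem_singleton] at hz
    rcases hz with hz | hz | hz
    · exact Or.inl hz
    · obtain ⟨i, hi, rfl⟩ := hp z hz
      exact absurd (hT i hi) hzT
    · exact Or.inr hz

/-- Each edge is replaced by an edge or a chain of trusted nodes, so no new untrusted node enters.
This is why correctness, and disjointness up to trusted nodes, survive the lift. -/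
lemma exists_walk_of_untrustedGraph_walk {x y : {x : V // x ∉ T}}
    (q : (untrustedGraph G T).Walk x y) :
    ∃ p : G.Walk x y, ∀ z ∈ p.support, ∀ h : z ∉ T, ⟨z, h⟩ ∈ q.support := by
  induction q with
  | nil => exact ⟨.nil, fun z hz h => by simpa [Subtype.ext_iff] using hz⟩
  | @cons x x' y hadj q ih =>
    obtain ⟨p, hp⟩ := ih
    obtain ⟨p', hp'⟩ := exists_walk_of_untrustedGraph_adj hadj
    refine ⟨p'.append p, fun z hz h => ?_⟩
    rw [SimpleGraph.Walk.support_cons]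
    rcases (SimpleGraph.Walk.mem_support_append_iff _ _).1 hz with hz | hz
    · rcases hp' z hz h with rfl | rfl
      · exact List.mem_cons_self
      · exact List.mem_cons_of_mem _ q.start_mem_support
    · exact List.mem_cons_of_mem _ (hp z hz h)

/-! ## Stored paths -/

lemma mem_storedPath {s x : V} {l : List V} : x ∈ storedPath T s l ↔ x ∈ l ∧ x ∉ T ∧ x ≠ s := by
  simp [storedPath]

lemma DeliveryCondition.mono {P Q : Set (List V)} (h : DeliveryCondition f P) (hPQ : P ⊆ Q) :
    DeliveryCondition f Q := by
  rcases h with h | ⟨R, hR, hc, hd⟩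
  · exact Or.inl (hPQ h)
  · exact Or.inr ⟨R, hR.trans hPQ, hc, hd⟩

/-- Paths that all meet a set of at most `f` nodes do not allow a delivery. -/
lemma not_deliveryCondition {P : Set (List V)} (S : Finset V) (hS : S.card ≤ f)
    (h : ∀ l ∈ P, ∃ b ∈ S, b ∈ l) : ¬ DeliveryCondition f P := by
  classical
  rintro (h0 | ⟨Q, hQ, hc, hd⟩)
  · obtain ⟨b, -, hb⟩ := h _ h0
    simp at hb
  · obtain ⟨l, hl⟩ : Q.Nonempty := Finset.card_pos.1 (by omega)
    have : Nonempty V := ⟨(h l (hQ hl)).choose⟩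
    choose! g hgS hgl using h
    have : Q.card ≤ S.card := Finset.card_le_card_of_injOn g (fun l hl => hgS l (hQ hl)) (by
      intro l hl l' hl' he
      by_contra hne
      exact hd hl hl' hne (hgl l (hQ hl)) (he ▸ hgl l' (hQ hl')))
    omega

/-! ## Single steps of the protocol -/

variable [Fintype V]

lemma mem_sendAll {i : V} {avoid : List V} {x : Message V M} {p : Packet V M} :
    p ∈ sendAll G i avoid x ↔ G.Adj i p.dst ∧ p.dst ∉ avoid ∧ p.src = i ∧ p.msg = x := by
  classical
  simp only [sendAll, Multiset.mem_map, Finset.mem_val, Finset.mem_filter, Finset.mem_univ,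
    true_and]
  constructor
  · rintro ⟨k, ⟨h1, h2⟩, rfl⟩
    exact ⟨h1, h2, rfl, rfl⟩
  · rintro ⟨h1, h2, h3, h4⟩
    exact ⟨p.dst, ⟨h1, h2⟩, by cases p; simp_all⟩

lemma mem_paths_next {c : Config V M} {ev : Event V M} {i : V} {x : V × M} {l : List V} :
    l ∈ ((next G T B c ev).loc i).paths x ↔ l ∈ (c.loc i).paths x ∨
      ∃ p, ev = .receive p ∧ p.dst ∉ B ∧ p.dst = i ∧ (p.msg.origin, p.msg.payload) = x ∧
        l = storedPath T p.msg.origin (p.msg.path ++ [p.src]) := by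
  classical
  cases ev with
  | broadcast j m =>
    by_cases h : i = j
    · subst h; simp [next, LocalState.markDelivered]
    · simp [next, h]
  | receive p =>
    by_cases hB : p.dst ∈ B
    · simp [next, hB]
    · by_cases h : i = p.dst
      · subst h
        by_cases hx : x = (p.msg.origin, p.msg.payload)
        · subst hx
          simp [next, hB, LocalState.store, or_comm]
        · simp [next, hB, LocalState.store, hx, Ne.symm hx]
      · simp [next, hB, h, Ne.symm h]
  | deliver j s m =>
    by_cases h : i = j
    · subst h; simp [next, LocalState.markDelivered]
    · simp [next, h]
  | byzSend p => simp [next]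
  | idle => simp [next]

lemma mem_delivered_next {c : Config V M} {ev : Event V M} {i s : V} {m : M} :
    (s, m) ∈ ((next G T B c ev).loc i).delivered ↔ (s, m) ∈ (c.loc i).delivered ∨
      ev = .deliver i s m ∨ (ev = .broadcast i m ∧ s = i) := by
  classical
  cases ev with
  | broadcast j m' =>
    by_cases h : i = j
    · subst h
      simp only [next, LocalState.markDelivered, Function.update_self, Set.mem_insert_iff,
        Prod.mk.injEq, reduceCtorEq, Event.broadcast.injEq, true_and, false_or]
      grind
    · simp [next, h, Ne.symm h]
  | receive p =>
    by_cases hB : p.dst ∈ B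
    · simp [next, hB]
    · by_cases h : i = p.dst
      · subst h
        simp [next, hB, LocalState.store]
      · simp [next, hB, h]
  | deliver j s' m' =>
    by_cases h : i = j
    · subst h
      simp only [next, LocalState.markDelivered, Function.update_self, Set.mem_insert_iff,
        Prod.mk.injEq, reduceCtorEq, Event.deliver.injEq, true_and, false_and, or_false]
      grind
    · simp [next, h, Ne.symm h]
  | byzSend p => simp [next]
  | idle => simp [next]

/-- The packets that an event puts on the channels. -/
noncomputable def sent (G : SimpleGraph V) (B : Finset V) : Event V M → Multiset (Packet V M)
  | .broadcast i m => sendAll G i [] ⟨i, m, []⟩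
  | .receive p => open scoped Classical in if p.dst ∈ B then 0 else
      sendAll G p.dst (p.msg.path ++ [p.src])
        ⟨p.msg.origin, p.msg.payload, p.msg.path ++ [p.src]⟩
  | .byzSend p => {p}
  | _ => 0

lemma mem_net_next {c : Config V M} {ev : Event V M} {p : Packet V M}
    (h : p ∈ (next G T B c ev).net) : p ∈ c.net ∨ p ∈ sent G B ev := by
  classical
  cases ev with
  | broadcast i m => simpa [next, sent] using h
  | receive q =>
    by_cases hB : q.dst ∈ B
    · simp only [next, hB, if_true] at h
      exact Or.inl (Multiset.mem_of_mem_erase h)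
    · simp only [next, hB, if_false, Multiset.mem_add] at h
      rcases h with h | h
      · exact Or.inl (Multiset.mem_of_mem_erase h)
      · exact Or.inr (by simpa [sent, hB] using h)
  | deliver i s m => exact Or.inl h
  | byzSend q =>
    simp only [next, Multiset.mem_cons] at h
    simpa [sent, or_comm] using h
  | idle => exact Or.inl h

lemma mem_net_next_of_mem_sent {c : Config V M} {ev : Event V M} {p : Packet V M}
    (h : p ∈ sent G B ev) : p ∈ (next G T B c ev).net := by
  classical
  cases ev with
  | broadcast i m => exact Multiset.mem_add.2 (Or.inr h)
  | receive q =>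
    by_cases hB : q.dst ∈ B
    · simp [sent, hB] at h
    · simp only [sent, hB, if_false] at h
      simp [next, hB, h]
  | deliver i s m => simp [sent] at h
  | byzSend q => simpa [next] using Or.inl (by simpa [sent] using h)
  | idle => simp [sent] at h

/-! ### Safety and validity in arbitrary executions. -/

namespace Execution

variable (E : Execution M G T f B)

lemma paths_mono (i : V) (x : V × M) : Monotone fun t => ((E.config t).loc i).paths x := by
  refine monotone_nat_of_le_succ fun t l hl => ?_
  rw [E.step]
  exact mem_paths_next.2 (Or.inl hl)

lemma mem_delivered_iff (t : ℕ) (r s : V) (m : M) :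
    (s, m) ∈ ((E.config t).loc r).delivered ↔ ∃ t' < t, E.DeliversAt t' r s m := by
  induction t with
  | zero => simp [E.init, Config.init]
  | succ t ih =>
    rw [E.step, mem_delivered_next, ih]
    simp only [Nat.lt_succ_iff_lt_or_eq, or_and_right, exists_or, exists_eq_left, DeliversAt]

lemma event_of_deliversAt {t : ℕ} {r s : V} {m : M} (hrs : r ≠ s) (h : E.DeliversAt t r s m) :
    E.event t = .deliver r s m :=
  h.resolve_right fun h => hrs h.2.symm

lemma deliversAt_unique {t t' : ℕ} {r s : V} {m : M} (hrs : r ≠ s) (h : E.DeliversAt t r s m)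
    (h' : E.DeliversAt t' r s m) : t = t' := by
  have key : ∀ t t', E.DeliversAt t r s m → E.DeliversAt t' r s m → ¬ t < t' := by
    intro t t' h h' hlt
    have hen := E.enabled t'
    rw [E.event_of_deliversAt hrs h'] at hen
    exact hen.2.1 ((E.mem_delivered_iff _ _ _ _).2 ⟨t, hlt, h⟩)
  exact le_antisymm (not_lt.1 (key t' t h' h)) (not_lt.1 (key t t' h h'))

/-- As long as a correct process `s` has not broadcast `m`, all paths of messages for `(s, m)` and
all stored ones contain a Byzantine process. -/
lemma byzantine_mem_path {s : V} {m : M} (hsB : s ∉ B) (hBT : ∀ b ∈ B, b ∉ T) (t : ℕ)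
    (h : ∀ t' < t, E.event t' ≠ .broadcast s m) :
    (∀ p ∈ (E.config t).net, p.msg.origin = s → p.msg.payload = m →
      ∃ b ∈ B, b ∈ p.msg.path ++ [p.src]) ∧
    ∀ i, ∀ l ∈ ((E.config t).loc i).paths (s, m), ∃ b ∈ B, b ∈ l := by
  induction t with
  | zero => simp [E.init, Config.init]
  | succ t ih =>
    obtain ⟨ih1, ih2⟩ := ih fun t' ht' => h t' (by omega)
    have hev := h t (by omega)
    have hen := E.enabled t
    rw [E.step]
    generalize E.event t = ev at hev hen
    constructor
    · intro p hp hps hpm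
      rcases mem_net_next hp with hp | hp
      · exact ih1 p hp hps hpm
      · cases ev with
        | broadcast i m' =>
          obtain ⟨-, -, -, hmsg⟩ := mem_sendAll.1 hp
          rw [hmsg] at hps hpm
          exact absurd (by simp_all) hev
        | receive q =>
          by_cases hB : q.dst ∈ B
          · simp [sent, hB] at hp
          · simp only [sent, hB, if_false] at hp
            obtain ⟨-, -, -, hmsg⟩ := mem_sendAll.1 hp
            rw [hmsg] at hps hpm ⊢
            obtain ⟨b, hb, hbp⟩ := ih1 q hen hps hpm
            exact ⟨b, hb, List.mem_append_left _ hbp⟩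
        | deliver i s m => simp [sent] at hp
        | byzSend q =>
          simp only [sent, Multiset.mem_singleton] at hp
          subst hp
          exact ⟨p.src, hen.1, by simp⟩
        | idle => simp [sent] at hp
    · intro i l hl
      rcases mem_paths_next.1 hl with hl | ⟨p, rfl, -, -, hx, rfl⟩
      · exact ih2 i l hl
      · obtain ⟨hps, hpm⟩ := Prod.mk.injEq _ _ _ _ ▸ hx
        obtain ⟨b, hb, hbp⟩ := ih1 p hen hps hpm
        exact ⟨b, hb, mem_storedPath.2 ⟨hbp, hBT b hb, fun h => hsB (by rw [← hps, ← h]; exact hb)⟩⟩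

/-- Without a broadcast, the at most `f` nodes of `B` meet all stored paths, which rules out the
delivery condition. -/
lemma exists_broadcast_of_deliversAt {t : ℕ} {r s : V} {m : M} (hrs : r ≠ s) (hsB : s ∉ B)
    (hBT : ∀ b ∈ B, b ∉ T) (hB : B.card ≤ f) (h : E.DeliversAt t r s m) :
    ∃ t' ≤ t, E.event t' = .broadcast s m := by
  by_contra! hcon
  have hen := E.enabled t
  rw [E.event_of_deliversAt hrs h] at hen
  exact not_deliveryCondition B hB
    ((E.byzantine_mem_path hsB hBT t fun t' ht' => hcon t' ht'.le).2 r) hen.2.2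

/-- A message in transit to a correct node travels on along every path of correct nodes that avoids
its dissemination path. -/
lemma exists_storedPath_mem_of_walk {s : V} {m : M} {x v : V} (q : G.Walk x v) :
    ∀ (l : List V) (y : V) (t : ℕ), (⟨y, x, ⟨s, m, l⟩⟩ : Packet V M) ∈ (E.config t).net →
      (l ++ [y] ++ q.support).Nodup → (∀ z ∈ q.support, z ∉ B) →
      ∃ t', storedPath T s (l ++ [y] ++ q.support.dropLast) ∈
        ((E.config t').loc v).paths (s, m) := by
  induction q with
  | @nil x =>
    intro l y t ht hnd hB
    obtain ⟨t', -, ht'⟩ := E.fair_receive t _ ht (hB x (by simp))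
    refine ⟨t' + 1, ?_⟩
    rw [E.step, ht']
    exact mem_paths_next.2 (Or.inr ⟨_, rfl, hB x (by simp), rfl, rfl, by simp⟩)
  | @cons x x' v hadj q ih =>
    intro l y t ht hnd hB
    have hxB := hB x (by simp)
    obtain ⟨t', -, ht'⟩ := E.fair_receive t _ ht hxB
    rw [SimpleGraph.Walk.support_cons] at hnd hB
    have hnet : (⟨x, x', ⟨s, m, l ++ [y]⟩⟩ : Packet V M) ∈ (E.config (t' + 1)).net := by
      rw [E.step, ht']
      refine mem_net_next_of_mem_sent ?_
      simp only [sent, hxB, if_false]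
      refine mem_sendAll.2 ⟨hadj, fun h => ?_, rfl, rfl⟩
      -- The absence of repetitions puts the next node outside the path, so the protocol does
      -- forward to it.
      exact List.disjoint_of_nodup_append hnd h (List.mem_cons_of_mem _ q.start_mem_support)
    obtain ⟨t'', h''⟩ := ih (l ++ [y]) x (t' + 1) hnet (by simpa using hnd)
      fun z hz => hB z (List.mem_cons_of_mem _ hz)
    refine ⟨t'', ?_⟩
    rw [SimpleGraph.Walk.support_cons, List.dropLast_cons_of_ne_nil q.support_ne_nil]
    simpa using h''

lemma exists_storedPath_mem {s v : V} {m : M} {t : ℕ} (ht : E.event t = .broadcast s m)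
    (hsv : s ≠ v) (p : G.Walk s v) (hp : p.IsPath) (hB : ∀ z ∈ p.support, z ∉ B) :
    ∃ t', storedPath T s p.support.dropLast ∈ ((E.config t').loc v).paths (s, m) := by
  cases p with
  | nil => exact absurd rfl hsv
  | @cons _ x _ hadj q =>
    have hnd := hp.support_nodup
    rw [SimpleGraph.Walk.support_cons] at hnd hB ⊢
    rw [List.dropLast_cons_of_ne_nil q.support_ne_nil]
    refine E.exists_storedPath_mem_of_walk q [] s (t + 1) ?_ (by simpa using hnd)
      fun z hz => hB z (List.mem_cons_of_mem _ hz)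
    rw [E.step, ht]
    exact mem_net_next_of_mem_sent (mem_sendAll.2 ⟨hadj, by simp, rfl, rfl⟩)

/-- Stored paths only accumulate, so the condition persists. When fairness shows the delivery to be
disabled, the only possible reason is that it has already happened. -/
lemma exists_deliversAt_of_deliveryCondition {r s : V} {m : M} {t : ℕ} (hr : r ∉ B)
    (h : DeliveryCondition f (((E.config t).loc r).paths (s, m))) :
    ∃ t', E.DeliversAt t' r s m := by
  obtain ⟨t', htt', hen⟩ := E.fair_deliver t r s m
  by_contra! hcon
  refine hen ⟨hr, fun hd => ?_, h.mono (E.paths_mono r (s, m) htt')⟩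
  obtain ⟨t'', -, h''⟩ := (E.mem_delivered_iff _ _ _ _).1 hd
  exact hcon t'' h''

/-- A correct walk in the untrusted graph makes its end store a path of its inner nodes. -/
lemma exists_mem_paths_of_untrustedGraph_walk {u v : {x : V // x ∉ T}} (huv : u ≠ v) {m : M}
    {t : ℕ} (ht : E.event t = .broadcast (u : V) m) (hBT : ∀ b ∈ B, b ∉ T)
    (q : (untrustedGraph G T).Walk u v) (hB : ∀ z ∈ q.support, (z : V) ∉ B) :
    ∃ t', ∃ l ∈ ((E.config t').loc v).paths (u, m),
      ∀ z ∈ l, ∃ h : z ∉ T, ⟨z, h⟩ ∈ q.support ∧ z ≠ u ∧ z ≠ v := by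
  classical
  obtain ⟨p, hp⟩ := exists_walk_of_untrustedGraph_walk q
  -- Messages are never forwarded to a node on their path, so the lifted walk is first shortened to
  -- a path.
  obtain ⟨t', ht'⟩ := E.exists_storedPath_mem ht (fun h => huv (Subtype.ext h)) p.bypass
    p.bypass_isPath (fun z hz hzB =>
      hB _ (hp z (p.support_bypass_subset_support hz) (hBT z hzB)) hzB)
  refine ⟨t', _, ht', fun z hz => ?_⟩
  obtain ⟨hz, hzT, hzu⟩ := mem_storedPath.1 hz
  refine ⟨hzT, hp z (p.support_bypass_subset_support (List.mem_of_mem_dropLast hz)) hzT, hzu, ?_⟩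
  rintro rfl
  have hnd := p.bypass_isPath.support_nodup
  rw [← List.dropLast_append_getLast p.bypass.support_ne_nil] at hnd
  exact List.disjoint_of_nodup_append hnd hz (by simp)

/-- Sufficiency in one direction; the connectivity hypothesis serves only validity. -/
lemma reliableFromTo {u v : {x : V // x ∉ T}} (huv : u ≠ v) (hB : B.card ≤ f)
    (hBT : ∀ b ∈ B, b ∉ T) (hu : (u : V) ∉ B) (hv : (v : V) ∉ B)
    (h : (untrustedGraph G T).Adj u v ∨
      ∀ S, (untrustedGraph G T).IsVertexSeparator u v S → 2 * f + 1 ≤ S.card) :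
    E.ReliableFromTo u v := by
  classical
  have huv' : (v : V) ≠ u := fun h => huv (Subtype.ext h.symm)
  refine ⟨fun m t t' => E.deliversAt_unique huv',
    fun m t => E.exists_broadcast_of_deliversAt huv' hu hBT hB, fun m t ht => ?_⟩
  suffices ∃ t', DeliveryCondition f (((E.config t').loc v).paths (u, m)) by
    obtain ⟨t', ht'⟩ := this
    exact E.exists_deliversAt_of_deliveryCondition hv ht'
  by_cases hadj : (untrustedGraph G T).Adj u v
  · obtain ⟨t', l, hl, hlz⟩ := E.exists_mem_paths_of_untrustedGraph_walk huv ht hBT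
      (.cons hadj .nil) (by simp [hu, hv])
    refine ⟨t', Or.inl ?_⟩
    rwa [← List.eq_nil_iff_forall_not_mem.2 fun z hz => ?_]
    obtain ⟨_, hzs, hzu, hzv⟩ := hlz z hz
    simp [Subtype.ext_iff, hzu, hzv] at hzs
  · have hcard : (B.subtype (· ∉ T)).card ≤ f :=
      ((Finset.card_subtype _ _).trans_le (Finset.card_filter_le _ _)).trans hB
    -- The untrusted Byzantine nodes are the forbidden set, and `(f + 1) + |B| ≤ 2f + 1`.
    obtain ⟨w, hwB, hwd⟩ := SimpleGraph.exists_disjoint_walks_of_separator_card huv hadj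
      (B.subtype (· ∉ T)) (by simpa using hu) (by simpa using hv) (f + 1) fun S hS => by
        have := h.resolve_left hadj S hS
        omega
    have key := fun i => E.exists_mem_paths_of_untrustedGraph_walk huv ht hBT (w i)
      fun z hz hzB => hwB i z hz (by simpa using hzB)
    choose τ l hl hlz using key
    have hl' : ∀ i, l i ∈ ((E.config (Finset.univ.sup τ)).loc v).paths (u, m) := fun i =>
      E.paths_mono v (u, m) (Finset.le_sup (Finset.mem_univ i)) (hl i)
    have hdisj : ∀ i j, i ≠ j → List.Disjoint (l i) (l j) := by
      intro i j hij z hz hz'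
      obtain ⟨_, hi, hzu, hzv⟩ := hlz i z hz
      obtain ⟨_, hj, -, -⟩ := hlz j z hz'
      rcases hwd i j hij _ hi hj with h | h
      · exact hzu (congrArg Subtype.val h)
      · exact hzv (congrArg Subtype.val h)
    refine ⟨Finset.univ.sup τ, ?_⟩
    -- An empty list is disjoint from itself, so disjointness gives `f + 1` distinct lists only if
    -- none is empty. An empty one suffices for delivery by itself.
    by_cases hnil : ∃ i, l i = []
    · obtain ⟨i, hi⟩ := hnil
      exact Or.inl (hi ▸ hl' i)
    · have hinj : Function.Injective l := by
        intro i j hij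
        by_contra hne
        obtain ⟨z, hz⟩ := List.exists_mem_of_ne_nil _ fun h => hnil ⟨i, h⟩
        exact hdisj i j hne hz (hij ▸ hz)
      refine Or.inr ⟨Finset.univ.image l, ?_, ?_, ?_⟩
      · simpa [Set.subset_def] using hl'
      · rw [Finset.card_image_of_injective _ hinj, Finset.card_univ, Fintype.card_fin]
      · intro a ha b hb hab
        obtain ⟨i, -, rfl⟩ := Finset.mem_image.1 ha
        obtain ⟨j, -, rfl⟩ := Finset.mem_image.1 hb
        exact hdisj i j fun h => hab (by rw [h])

end Execution

end DolevUT

namespace DolevUT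

variable {V M : Type*} {G : SimpleGraph V} {T : Set V} {f : ℕ} {B : Finset V}

/-! ## Dissemination among the correct processes -/

/-- `l` is a list of correct nodes that are passed in this order on a walk from `u` to the given
node. -/
inductive CorrectTrail (G : SimpleGraph V) (B : Finset V) (u : V) : List V → V → Prop
  | start : CorrectTrail G B u [] u
  | snoc {l : List V} {x y : V} : CorrectTrail G B u l x → G.Adj x y → x ∉ B →
      CorrectTrail G B u (l ++ [x]) y

lemma CorrectTrail.notMem {u x : V} {l : List V} (h : CorrectTrail G B u l x) :
    ∀ z ∈ l, z ∉ B := by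
  induction h with
  | start => simp
  | snoc _ _ hx ih =>
    intro z hz
    rcases List.mem_append.1 hz with hz | hz
    · exact ih z hz
    · rwa [List.mem_singleton.1 hz]

/-- A trail that avoids `S` follows a walk in the untrusted graph that avoids `S`, up to a final
chain of trusted nodes. -/
lemma CorrectTrail.exists_untrustedGraph_walk {u : {x : V // x ∉ T}} {x : V} {l : List V}
    (S : Finset {x : V // x ∉ T}) (h : CorrectTrail G B u l x)
    (hS : ∀ z ∈ l ++ [x], ∀ hz : z ∉ T, ⟨z, hz⟩ ∉ S) :
    ∃ (y : {x : V // x ∉ T}) (q : (untrustedGraph G T).Walk u y), (∀ z ∈ q.support, z ∉ S) ∧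
      (x = y ∨ ∃ (n : ℕ) (t : ℕ → V), (∀ i ≤ n, t i ∈ T) ∧ G.Adj y (t 0) ∧ t n = x ∧
        ∀ i < n, G.Adj (t i) (t (i + 1))) := by
  induction h with
  | start => exact ⟨u, .nil, by simpa using hS u (by simp) u.2, Or.inl rfl⟩
  | @snoc l x x' h hadj hx ih =>
    obtain ⟨y, q, hq, hxy⟩ := ih fun z hz => hS z (List.mem_append_left _ hz)
    by_cases hT : x' ∈ T
    · refine ⟨y, q, hq, Or.inr ?_⟩
      rcases hxy with rfl | ⟨n, t, ht, h0, rfl, hs⟩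
      · exact ⟨0, fun _ => x', fun _ _ => hT, hadj, rfl, by simp⟩
      · refine ⟨n + 1, fun i => if i ≤ n then t i else x', fun i _ => ?_, by simpa using h0,
          by simp, fun i hi => ?_⟩
        · by_cases hin : i ≤ n
          · simpa [hin] using ht i hin
          · simpa [hin] using hT
        · rcases Nat.lt_succ_iff_lt_or_eq.1 hi with hin | rfl
          · simpa [hin.le, Nat.succ_le_of_lt hin] using hs i hin
          · simpa using hadj
    · have hx'S : (⟨x', hT⟩ : {x : V // x ∉ T}) ∉ S := hS x' (by simp) hT
      -- The trusted chain may return to its starting node, which gives no edge of the loopless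
      -- graph; the walk then stays as it is.
      by_cases hyx : y = ⟨x', hT⟩
      · exact ⟨y, q, hq, Or.inl (by rw [hyx])⟩
      · have hyadj : (untrustedGraph G T).Adj y ⟨x', hT⟩ := by
          refine ⟨hyx, ?_⟩
          rcases hxy with rfl | ⟨n, t, ht, h0, rfl, hs⟩
          · exact Or.inl hadj
          · exact Or.inr ⟨n, t, ht, h0, hadj, hs⟩
        refine ⟨⟨x', hT⟩, q.concat hyadj, fun z hz => ?_, Or.inl rfl⟩
        rw [SimpleGraph.Walk.support_concat, List.mem_append, List.mem_singleton] at hz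
        rcases hz with hz | rfl
        · exact hq z hz
        · exact hx'S

/-- As `v` is untrusted, no trusted chain ends in it, so a trail that avoided `S` would give a whole
walk from `u` to `v` avoiding `S`. -/
lemma CorrectTrail.exists_mem_separator {u v : {x : V // x ∉ T}} {l : List V}
    {S : Finset {x : V // x ∉ T}} (hS : (untrustedGraph G T).IsVertexSeparator u v S)
    (h : CorrectTrail G B u l v) : ∃ z ∈ l, ∃ hz : z ∉ T, ⟨z, hz⟩ ∈ S := by
  by_contra! hcon
  obtain ⟨y, q, hq, hvy⟩ := h.exists_untrustedGraph_walk S (by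
    intro z hz hzT
    rcases List.mem_append.1 hz with hz | hz
    · exact hcon z hz hzT
    · obtain rfl := List.mem_singleton.1 hz
      exact hS.2.1)
  rcases hvy with hvy | ⟨n, t, ht, -, hn, -⟩
  · obtain rfl := Subtype.ext hvy
    obtain ⟨z, hz, hzS⟩ := hS.2.2 q
    exact hq z hz hzS
  · exact v.2 (hn ▸ ht n le_rfl)

/-! ## An execution with a single broadcast and silent Byzantine processes -/

/-- All messages and stored paths of the configuration stem from a broadcast of `m` by `u` that was
forwarded by correct processes. -/
structure Genuine (G : SimpleGraph V) (T : Set V) (B : Finset V) (u : V) (m : M)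
    (c : Config V M) : Prop where
  net : ∀ p ∈ c.net, p.msg.origin = u ∧ p.msg.payload = m ∧
    CorrectTrail G B u (p.msg.path ++ [p.src]) p.dst ∧ (p.msg.path ++ [p.src] ++ [p.dst]).Nodup
  paths : ∀ i x, ∀ l ∈ (c.loc i).paths x, x = (u, m) ∧
    ∃ l', CorrectTrail G B u l' i ∧ l = storedPath T u l'

variable [Fintype V]

open scoped Classical in
/-- A bound for the number of receptions and deliveries to come. -/
noncomputable def workload (u : V) (m : M) (c : Config V M) : ℕ :=
  (c.net.map fun p => (Fintype.card V + 1) ^ (Fintype.card V - p.msg.path.length)).sum +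
    (Finset.univ.filter fun i => (u, m) ∉ (c.loc i).delivered).card

lemma genuine_next_broadcast {u : V} (hu : u ∉ B) (m : M) :
    Genuine G T B u m (next G T B (Config.init V M) (.broadcast u m)) where
  net p hp := by
    rcases mem_net_next hp with hp | hp
    · simp [Config.init] at hp
    · obtain ⟨hadj, -, hsrc, hmsg⟩ := mem_sendAll.1 hp
      rw [hmsg, hsrc]
      exact ⟨rfl, rfl, .snoc .start hadj hu, by simpa using hadj.ne⟩
  paths i x l hl := by
    rcases mem_paths_next.1 hl with hl | ⟨_, h, _⟩
    · simp [Config.init] at hl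
    · cases h

/-- Forwarding only to nodes outside the path keeps its nodes distinct, which is what bounds the
path lengths. -/
lemma Genuine.next_receive {u : V} {m : M} {c : Config V M} (hc : Genuine G T B u m c)
    {p : Packet V M} (hp : p ∈ c.net) : Genuine G T B u m (next G T B c (.receive p)) := by
  obtain ⟨ho, hm, htr, hnd⟩ := hc.net p hp
  constructor
  · intro q hq
    rcases mem_net_next hq with hq | hq
    · exact hc.net q hq
    · by_cases hB : p.dst ∈ B
      · simp [sent, hB] at hq
      · simp only [sent, hB, if_false] at hq
        obtain ⟨hadj, hav, hsrc, hmsg⟩ := mem_sendAll.1 hq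
        rw [hmsg, hsrc]
        refine ⟨ho, hm, .snoc htr hadj hB, ?_⟩
        refine List.Nodup.append hnd (List.nodup_singleton _) ?_
        rw [List.disjoint_singleton, List.mem_append, List.mem_singleton, not_or]
        exact ⟨hav, hadj.ne'⟩
  · intro i x l hl
    rcases mem_paths_next.1 hl with hl | ⟨q, h, -, rfl, rfl, rfl⟩
    · exact hc.paths i x l hl
    · cases h
      exact ⟨by rw [ho, hm], _, htr, by rw [ho]⟩

lemma Genuine.next_deliver {u : V} {m : M} {c : Config V M} (hc : Genuine G T B u m c)
    (i : V) : Genuine G T B u m (next G T B c (.deliver i u m)) where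
  net p hp := hc.net p hp
  paths j x l hl := by
    rcases mem_paths_next.1 hl with hl | ⟨_, h, _⟩
    · exact hc.paths j x l hl
    · cases h

/-- With `N` nodes, a packet whose path has length `ℓ` weighs `(N + 1) ^ (N - ℓ)`. It is replaced by
at most `N` packets with longer paths, each lighter by a factor `N + 1`. Distinctness of the nodes
keeps the exponent positive. -/
lemma Genuine.workload_next_receive_lt {u : V} {m : M} {c : Config V M}
    (hc : Genuine G T B u m c) {p : Packet V M} (hp : p ∈ c.net) :
    workload u m (next G T B c (.receive p)) < workload u m c := by
  classical
  obtain ⟨-, -, -, hnd⟩ := hc.net p hp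
  have hlen : p.msg.path.length + 2 ≤ Fintype.card V := by
    simpa using hnd.length_le_card
  have hdel : (Finset.univ.filter fun i =>
      (u, m) ∉ ((next G T B c (.receive p)).loc i).delivered) =
      Finset.univ.filter fun i => (u, m) ∉ (c.loc i).delivered := by
    ext i
    simp [mem_delivered_next]
  unfold workload
  rw [hdel]
  refine Nat.add_lt_add_right ?_ _
  obtain ⟨k, hk⟩ : ∃ k, Fintype.card V - p.msg.path.length = k + 1 :=
    ⟨Fintype.card V - p.msg.path.length - 1, by omega⟩
  conv_rhs => rw [← Multiset.cons_erase hp]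
  rw [Multiset.map_cons, Multiset.sum_cons, hk]
  by_cases hB : p.dst ∈ B
  · simp only [next, hB, if_true]
    have : 0 < (Fintype.card V + 1) ^ (k + 1) := by positivity
    omega
  · simp only [next, hB, if_false, Multiset.map_add, Multiset.sum_add]
    rw [add_comm]
    refine Nat.add_lt_add_right ?_ _
    have hcard : Multiset.card (sendAll G p.dst (p.msg.path ++ [p.src])
        ⟨p.msg.origin, p.msg.payload, p.msg.path ++ [p.src]⟩) ≤ Fintype.card V := by
      rw [sendAll, Multiset.card_map]
      exact Finset.card_le_univ _
    refine lt_of_le_of_lt (Multiset.sum_le_card_nsmul _ ((Fintype.card V + 1) ^ k) ?_) ?_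
    · intro w hw
      obtain ⟨q, hq, rfl⟩ := Multiset.mem_map.1 hw
      obtain ⟨-, -, -, hmsg⟩ := mem_sendAll.1 hq
      rw [hmsg]
      refine Nat.pow_le_pow_right (by omega) ?_
      simp only [List.length_append, List.length_singleton]
      omega
    · rw [Multiset.card_map, smul_eq_mul, pow_succ, mul_comm _ (Fintype.card V + 1)]
      exact Nat.mul_lt_mul_of_pos_right (by omega) (by positivity)

lemma workload_next_deliver_lt {u i : V} {m : M} {c : Config V M}
    (hi : (u, m) ∉ (c.loc i).delivered) :
    workload u m (next G T B c (.deliver i u m)) < workload u m c := by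
  classical
  unfold workload
  refine Nat.add_lt_add_left (Finset.card_lt_card ?_) _
  rw [Finset.ssubset_iff_of_subset]
  · exact ⟨i, by simpa using hi, by simp [mem_delivered_next]⟩
  · intro j
    simp only [Finset.mem_filter, Finset.mem_univ, true_and, mem_delivered_next, not_or]
    exact fun h => h.1

/-- No message is in transit and no delivery is enabled. -/
def Quiescent (G : SimpleGraph V) (f : ℕ) (B : Finset V) (c : Config V M) : Prop :=
  c.net = 0 ∧ ∀ i s m, ¬ Enabled G f B c (.deliver i s m)

/-- A greedy scheduler: receive while anything is in transit, then deliver while possible, and idle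
only in quiescence. -/
lemma Genuine.exists_event {u : V} {m : M} {c : Config V M} (hc : Genuine G T B u m c) :
    ∃ ev, Enabled G f B c ev ∧ Genuine G T B u m (next G T B c ev) ∧
      (Quiescent G f B c ∨ workload u m (next G T B c ev) < workload u m c) := by
  by_cases hnet : c.net = 0
  · by_cases hd : ∃ i, Enabled G f B c (.deliver i u m)
    · obtain ⟨i, hi⟩ := hd
      exact ⟨_, hi, hc.next_deliver i, Or.inr (workload_next_deliver_lt hi.2.1)⟩
    · refine ⟨.idle, trivial, hc, Or.inl ⟨hnet, fun i s m' h => hd ?_⟩⟩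
      have hx : (s, m') = (u, m) := by
        by_contra hne
        refine not_deliveryCondition ∅ (by simp) (fun l hl => ?_) h.2.2
        exact absurd (hc.paths i _ l hl).1 hne
      obtain ⟨rfl, rfl⟩ := Prod.mk.inj hx
      exact ⟨i, h⟩
  · obtain ⟨p, hp⟩ := Multiset.exists_mem_of_ne_zero hnet
    exact ⟨.receive p, hp, hc.next_receive hp, Or.inr (hc.workload_next_receive_lt hp)⟩

lemma mem_net_next_of_ne {c : Config V M} {ev : Event V M} {p : Packet V M} (hp : p ∈ c.net)
    (h : ev ≠ .receive p) : p ∈ (next G T B c ev).net := by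
  classical
  cases ev with
  | broadcast i m => exact Multiset.mem_add.2 (Or.inl hp)
  | receive q =>
    have hpq : p ∈ c.net.erase q := (Multiset.mem_erase_of_ne fun e => h (by rw [e])).2 hp
    by_cases hB : q.dst ∈ B
    · simpa [next, hB] using hpq
    · simpa [next, hB] using Or.inl hpq
  | deliver i s m => exact hp
  | byzSend q => exact Multiset.mem_cons_of_mem hp
  | idle => exact hp

/-- There is an execution that starts with a broadcast of `m` by `u` and has no other messages than
those that correct processes forward. -/
lemma exists_genuine_execution {u : V} (hu : u ∉ B) (m : M) :
    ∃ E : Execution M G T f B, E.event 0 = .broadcast u m ∧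
      ∀ t, Genuine G T B u m (E.config (t + 1)) := by
  choose ev hen hgen hwork using
    fun c : {c : Config V M // Genuine G T B u m c} => c.2.exists_event (f := f)
  let σ : ℕ → {c : Config V M // Genuine G T B u m c} := fun n =>
    Nat.rec ⟨_, genuine_next_broadcast hu m⟩ (fun _ c => ⟨_, hgen c⟩) n
  -- Times are shifted by one: `σ` starts after the broadcast, which is the event at time 0.
  let config : ℕ → Config V M := fun n => Nat.casesOn n (Config.init V M) fun n => (σ n).1
  let event : ℕ → Event V M := fun n => Nat.casesOn n (.broadcast u m) fun n => ev (σ n)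
  have hstep : ∀ t, config (t + 1) = next G T B (config t) (event t) := by
    intro t
    cases t <;> rfl
  have hquiet : ∀ t, ∃ t' ≥ t, Quiescent G f B (config t') := by
    have key : ∀ w n, workload u m (σ n).1 = w → ∃ n' ≥ n, Quiescent G f B (σ n').1 := by
      intro w
      induction w using Nat.strong_induction_on with
      | _ w ih =>
        intro n hn
        rcases hwork (σ n) with h | h
        · exact ⟨n, le_rfl, h⟩
        · obtain ⟨n', hn', h'⟩ := ih _ (hn ▸ h) (n + 1) rfl
          exact ⟨n', by omega, h'⟩
    intro t
    obtain ⟨n', hn', h'⟩ := key _ t rfl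
    exact ⟨n' + 1, by omega, h'⟩
  refine ⟨⟨config, event, rfl, ?_, hstep, ?_, ?_⟩, rfl, fun t => (σ t).2⟩
  · intro t
    cases t with
    | zero => exact hu
    | succ t => exact hen (σ t)
  · intro t p hp _
    -- A packet that is never received would still be in transit at a later quiescent time.
    by_contra! hcon
    obtain ⟨t', htt', h'⟩ := hquiet t
    have hmem : ∀ t' ≥ t, p ∈ (config t').net := by
      intro t' ht'
      induction t', ht' using Nat.le_induction with
      | base => exact hp
      | succ k hk ih =>
        rw [hstep]
        exact mem_net_next_of_ne ih (hcon k hk)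
    have := hmem t' htt'
    rw [h'.1] at this
    simp at this
  · intro t i s m'
    obtain ⟨t', htt', h'⟩ := hquiet t
    exact ⟨t', htt', h'.2 i s m'⟩

/-- Necessity: if half of a small separator is silent, the other half, at most `f` nodes, meets
every path that `v` stores. The broadcaster is not in the separator, so the crossing node is not
erased. -/
lemma CommunicateReliably.lt_card_of_isVertexSeparator [Nonempty M] {u v : {x : V // x ∉ T}}
    (huv : u ≠ v) (h : CommunicateReliably M G T f (u : V) (v : V))
    {S : Finset {x : V // x ∉ T}} (hS : (untrustedGraph G T).IsVertexSeparator u v S) :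
    2 * f + 1 ≤ S.card := by
  classical
  by_contra! hcard
  let S' : Finset V := S.map (Function.Embedding.subtype _)
  have hmem : ∀ z, z ∈ S' ↔ ∃ hz : z ∉ T, ⟨z, hz⟩ ∈ S := by simp [S']
  have hS' : S'.card = S.card := Finset.card_map _
  -- The size `min f |S|` also covers separators with fewer than `f` nodes, and leaves at most `f`
  -- others since `|S| ≤ 2f`.
  obtain ⟨B, hBS, hB⟩ := Finset.exists_subset_card_eq (min_le_right f S'.card)
  have hdiff : (S' \ B).card ≤ f := by
    rw [Finset.card_sdiff_of_subset hBS]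
    omega
  have huS : (u : V) ∉ S' := fun h => hS.1 ((hmem _).1 h).2
  have hvS : (v : V) ∉ S' := fun h => hS.2.1 ((hmem _).1 h).2
  have hu : (u : V) ∉ B := fun h => huS (hBS h)
  have hv : (v : V) ∉ B := fun h => hvS (hBS h)
  obtain ⟨m⟩ := ‹Nonempty M›
  obtain ⟨E, hE0, hE⟩ := exists_genuine_execution (M := M) (G := G) (T := T) (f := f) hu m
  obtain ⟨t, ht⟩ := (h B (by omega) (fun b hb => ((hmem b).1 (hBS hb)).1) hu hv E).1.2.2 m 0 hE0
  have hev := E.event_of_deliversAt (fun h => huv (Subtype.ext h.symm)) ht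
  cases t with
  | zero => rw [hE0] at hev; cases hev
  | succ t =>
    have hen := E.enabled (t + 1)
    rw [hev] at hen
    refine not_deliveryCondition (S' \ B) hdiff (fun l hl => ?_) hen.2.2
    obtain ⟨-, l', hl', rfl⟩ := (hE t).paths _ _ l hl
    obtain ⟨z, hz, hzT, hzS⟩ := hl'.exists_mem_separator hS
    have hzS' := (hmem z).2 ⟨hzT, hzS⟩
    exact ⟨z, Finset.mem_sdiff.2 ⟨hzS', hl'.notMem z hz⟩,
      mem_storedPath.2 ⟨hz, hzT, fun h => huS (h ▸ hzS')⟩⟩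

end DolevUT

lemma SimpleGraph.IsVertexSeparator.symm {W : Type*} {H : SimpleGraph W} {a b : W} {S : Finset W}
    (h : H.IsVertexSeparator a b S) : H.IsVertexSeparator b a S :=
  ⟨h.2.1, h.1, fun p => by simpa using h.2.2 p.reverse⟩

lemma SimpleGraph.natCast_le_localVertexConnectivity_iff {W : Type*} {H : SimpleGraph W} {a b : W}
    {n : ℕ} : (n : ℕ∞) ≤ H.localVertexConnectivity a b ↔
      ∀ S, H.IsVertexSeparator a b S → n ≤ S.card := by
  simp [localVertexConnectivity]

theorem mainTheorem3 {V M : Type*} [Fintype V] [Nonempty M] (G : SimpleGraph V) (T : Set V)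
    (f : ℕ) (u v : {x : V // x ∉ T}) (huv : u ≠ v) :
    DolevUT.CommunicateReliably M G T f (u : V) (v : V) ↔
      u ∈ (DolevUT.untrustedGraph G T).neighborSet v ∨
        ((2 * f + 1 : ℕ) : ℕ∞) ≤ (DolevUT.untrustedGraph G T).localVertexConnectivity u v := by
  rw [SimpleGraph.natCast_le_localVertexConnectivity_iff, SimpleGraph.mem_neighborSet]
  constructor
  -- The second alternative covers adjacent nodes too: they have no separator, and the bound is
  -- vacuous.
  · exact fun h => Or.inr fun S hS => h.lt_card_of_isVertexSeparator huv hS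
  · intro h B hB hBT hu hv E
    exact ⟨E.reliableFromTo huv hB hBT hu hv (h.imp_left fun h => h.symm),
      E.reliableFromTo huv.symm hB hBT hv hu (h.imp_right fun h S hS => h S hS.symm)⟩
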